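/- Let $J>K>0$ be integers, $N=\binom{J}{K}$, and let $S_1,\dots,S_N$ enumerate the $K$-element subsets of $\{1,\dots,J\}$, with complements $\sim S_\alpha=\{1,\dots,J\}\setminus S_\alpha$. Let $0<p<q\le\infty$. Then for any $\sigma$-finite measure spaces $(X_1,\mu_1),\dots,(X_J,\mu_J)$ and any measurable function $f:X_1\times\cdots\times X_J\to\mathbb{C}$, $$\|f\|_{\frac{Jpq}{pJ+(q-p)K}}\le\prod_{\alpha=1}^N\left[\int_{S_\alpha}\left(\int_{\sim S_\alpha}|f|^q\right)^{p/q}\right]^{1/(Np)}.$$ Here, for $E\subset\{1,\dots,J\}$, $\int_E$ denotes integration over the product space $\prod_{k\in E}X_k$ with respect to the product measure, and $\|f\|_r=\left(\int_{\{1,\dots,J\}}|f|^r\right)^{1/r}$ for $0<r<\infty$, also when $r<1$. If $q=\infty$, the exponent on the left is read as its limit $Jp/K$, and $\left(\int_{\sim S_\alpha}|f|^q\right)^{1/q}$ is read as the essential supremum of $|f|$ over the variables in $\sim S_\alpha$. All quantities take values in $[0,\infty]$, with $0\cdot\infty=0$. -/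

import Mathlib

open MeasureTheory
open scoped ENNReal

/-- The point of `∏ i, X i` whose coordinates in `S` are those of `x` and whose coordinates in the
complement of `S` are those of `y`. -/
def gluePoint {J : ℕ} {X : Fin J → Type*} (S : Finset (Fin J))
    (x : (i : {i // i ∈ S}) → X i) (y : (i : {i // i ∉ S}) → X i) (i : Fin J) : X i :=
  if h : i ∈ S then x ⟨i, h⟩ else y ⟨i, h⟩

/-- The iterated integral `∫_S (∫_{∼S} |f|^q)^{p/q}` with values in `[0, ∞]`. The inner expression
`(∫_{∼S} |f|^q)^{1/q}` is `eLpNorm _ q`, which for `q = ∞` is the essential supremum. -/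
noncomputable def mixedIntegral {J : ℕ} {X : Fin J → Type*} [∀ i, MeasurableSpace (X i)]
    (μ : ∀ i, Measure (X i)) (p q : ℝ≥0∞) (S : Finset (Fin J)) (f : (∀ i, X i) → ℂ) : ℝ≥0∞ :=
  ∫⁻ x : ((i : {i // i ∈ S}) → X i),
    (eLpNorm (fun y : ((i : {i // i ∉ S}) → X i) => f (gluePoint S x y)) q
      (Measure.pi fun i : {i // i ∉ S} => μ i)) ^ p.toReal
    ∂(Measure.pi fun i : {i // i ∈ S} => μ i)

/-- The exponent `J p q / (p J + (q - p) K)`, read as its limit `J p / K` when `q = ∞`. -/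
noncomputable def bleiExponent (J K : ℕ) (p q : ℝ≥0∞) : ℝ≥0∞ :=
  if q = ∞ then J * p / K else J * p * q / (p * J + (q - p) * K)

/-! Put r for the exponent on the left and write |f| as the product over S of |f|^(1/N). To each S
belongs a mixed norm of |f|, with exponent p in the variables of S and q in the others, iterated in
one order of variables common to all S. Hölder, one variable at a time (`mixedNorm_prod_rpow_le`),
bounds the L^r norm by the geometric mean of these mixed norms. It applies because each index lies
in the proportion K/J of the sets S, so in every variable 1/r is the average (K/J)/p + (1 - K/J)/q
of the reciprocal exponents. Since p < q, Minkowski (`eLpNorm_eLpNorm_le`) lets the p-variables move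
outside at the cost of an increase (`mixedNorm_le_filter`), and the reordered norm is at most the
p-th root of the mixed integral. Minkowski is applied to |f|^p with exponent q/p > 1, so p < 1 is
harmless. -/

/-! ### Minkowski's inequality -/

open Filter Topology in
/-- Truncation for a `σ`-finite measure: to bound `∫ H ^ s`, it suffices to
bound `∫ k ^ s` for the measurable `k ≤ H` for which this is finite. -/
theorem lintegral_rpow_le_of_forall_le {β : Type*} [MeasurableSpace β] {ν : Measure β}
    [SigmaFinite ν] {s : ℝ} (hs : 0 < s) {H : β → ℝ≥0∞} (hH : Measurable H) {C : ℝ≥0∞}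
    (h : ∀ k : β → ℝ≥0∞, Measurable k → k ≤ H → ∫⁻ y, k y ^ s ∂ν ≠ ∞ → ∫⁻ y, k y ^ s ∂ν ≤ C) :
    ∫⁻ y, H y ^ s ∂ν ≤ C := by
  set k : ℕ → β → ℝ≥0∞ := fun n => (spanningSets ν n).indicator fun y => min (H y) n with hk
  have hkm : ∀ n, Measurable (k n) := fun n =>
    (hH.min measurable_const).indicator (measurableSet_spanningSets ν n)
  have hkH : ∀ n, k n ≤ H := fun n y => by
    by_cases hy : y ∈ spanningSets ν n <;> simp [hk, hy]
  have hmono : ∀ y, Monotone fun n => k n y := fun y m n hmn => by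
    by_cases hy : y ∈ spanningSets ν m
    · have hy' := monotone_spanningSets ν hmn hy
      simp only [hk, hy, hy', Set.indicator_of_mem]
      exact min_le_min le_rfl (by exact_mod_cast hmn)
    · simp [hk, hy]
  have hlim : ∀ y, Tendsto (fun n => k n y) atTop (𝓝 (H y)) := fun y => by
    have h1 : Tendsto (fun n : ℕ => min (H y) (n : ℝ≥0∞)) atTop (𝓝 (min (H y) ∞)) :=
      tendsto_const_nhds.min ENNReal.tendsto_nat_nhds_top
    rw [min_eq_left le_top] at h1
    refine h1.congr' ?_
    filter_upwards [eventually_ge_atTop (spanningSetsIndex ν y)] with n hn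
    have : y ∈ spanningSets ν n := monotone_spanningSets ν hn (mem_spanningSetsIndex ν y)
    simp [hk, this]
  refine le_of_tendsto' (lintegral_tendsto_of_tendsto_of_monotone
    (f := fun n y => k n y ^ s) (fun n => ((hkm n).pow_const s).aemeasurable)
    (ae_of_all _ fun y m n hmn => ENNReal.rpow_le_rpow (hmono y hmn) hs.le)
    (ae_of_all _ fun y => (ENNReal.continuous_rpow_const.tendsto _).comp (hlim y))) fun n => ?_
  refine h _ (hkm n) (hkH n) (ne_of_lt ?_)
  calc ∫⁻ y, k n y ^ s ∂ν
      ≤ ∫⁻ y, (spanningSets ν n).indicator (fun _ => (n : ℝ≥0∞) ^ s) y ∂ν := by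
        refine lintegral_mono fun y => ?_
        by_cases hy : y ∈ spanningSets ν n
        · simp only [hk, hy, Set.indicator_of_mem]
          exact ENNReal.rpow_le_rpow (min_le_right _ _) hs.le
        · simp [hk, hy, hs]
    _ = (n : ℝ≥0∞) ^ s * ν (spanningSets ν n) :=
        lintegral_indicator_const (measurableSet_spanningSets ν n) _
    _ < ∞ := ENNReal.mul_lt_top (ENNReal.rpow_lt_top_of_nonneg hs.le (by simp))
        (measure_spanningSets_lt_top ν n)

/-- **Minkowski's integral inequality**. -/
theorem lintegral_rpow_lintegral_le {α β : Type*} [MeasurableSpace α] [MeasurableSpace β]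
    {μ : Measure α} {ν : Measure β} [SFinite μ] [SigmaFinite ν] {s : ℝ} (hs : 1 < s)
    {G : α → β → ℝ≥0∞} (hG : Measurable (Function.uncurry G)) :
    (∫⁻ y, (∫⁻ x, G x y ∂μ) ^ s ∂ν) ^ (1 / s) ≤ ∫⁻ x, (∫⁻ y, G x y ^ s ∂ν) ^ (1 / s) ∂μ := by
  have hs0 : 0 < s := by linarith
  set H : β → ℝ≥0∞ := fun y => ∫⁻ x, G x y ∂μ with hHdef
  have hH : Measurable H := hG.lintegral_prod_left'
  set R := ∫⁻ x, (∫⁻ y, G x y ^ s ∂ν) ^ (1 / s) ∂μ with hR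
  rw [one_div, ENNReal.rpow_inv_le_iff hs0]
  refine lintegral_rpow_le_of_forall_le hs0 hH fun k hk hkH hfin => ?_
  set I := ∫⁻ y, k y ^ s ∂ν with hI
  have hGy : ∀ x, Measurable (G x) := fun x => hG.comp measurable_prodMk_left
  have hGx : ∀ y, Measurable fun x => G x y := fun y => hG.comp measurable_prodMk_right
  have hconj : s.HolderConjugate s.conjExponent := .conjExponent hs
  -- Split k^s = k · k^(s-1), bound the first factor by H, swap the integrals and apply Hölder in y.
  -- Dividing by I^(1/s') then needs I finite, which is why H was truncated.
  have hmul : I ≤ R * I ^ (1 / s.conjExponent) := calc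
    I ≤ ∫⁻ y, ∫⁻ x, G x y * k y ^ (s - 1) ∂μ ∂ν := by
        refine lintegral_mono fun y => ?_
        rw [lintegral_mul_const _ (hGx y)]
        calc k y ^ s = k y ^ (1 + (s - 1)) := by ring_nf
          _ = k y * k y ^ (s - 1) := by
            rw [ENNReal.rpow_add_of_nonneg _ _ zero_le_one (by linarith), ENNReal.rpow_one]
          _ ≤ H y * k y ^ (s - 1) := by gcongr; exact hkH y
    _ = ∫⁻ x, ∫⁻ y, G x y * k y ^ (s - 1) ∂ν ∂μ := by
        refine lintegral_lintegral_swap (Measurable.aemeasurable ?_)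
        exact (hG.comp measurable_swap).mul ((hk.comp measurable_fst).pow_const _)
    _ ≤ ∫⁻ x, (∫⁻ y, G x y ^ s ∂ν) ^ (1 / s) * I ^ (1 / s.conjExponent) ∂μ := by
        refine lintegral_mono fun x => ?_
        refine (ENNReal.lintegral_mul_le_Lp_mul_Lq ν hconj (hGy x).aemeasurable
          (hk.pow_const _).aemeasurable).trans_eq ?_
        simp_rw [← ENNReal.rpow_mul, hconj.sub_one_mul_conj]
        rfl
    _ = R * I ^ (1 / s.conjExponent) := lintegral_mul_const _
        ((hG.pow_const s).lintegral_prod_right'.pow_const _)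
  rcases eq_or_ne I 0 with h0 | h0
  · simp [h0]
  rw [← ENNReal.rpow_inv_le_iff hs0]
  have hpow : I = I ^ s⁻¹ * I ^ (1 / s.conjExponent) := by
    rw [← ENNReal.rpow_add _ _ h0 hfin, one_div, hconj.inv_add_inv_eq_one, ENNReal.rpow_one]
  have hne0 : I ^ (1 / s.conjExponent) ≠ 0 := by simp [h0, hfin]
  have hnet : I ^ (1 / s.conjExponent) ≠ ∞ :=
    ENNReal.rpow_ne_top_of_nonneg (by simpa using hconj.symm.nonneg) hfin
  calc I ^ s⁻¹ = I / I ^ (1 / s.conjExponent) := by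
        conv_rhs => enter [1]; rw [hpow]
        rw [ENNReal.mul_div_cancel_right hne0 hnet]
    _ ≤ R := ENNReal.div_le_of_le_mul hmul

theorem measurable_eLpNorm_right {α β : Type*} [MeasurableSpace α] [MeasurableSpace β]
    {ν : Measure β} [SFinite ν] {F : α → β → ℝ≥0∞} (hF : Measurable (Function.uncurry F))
    {p : ℝ≥0∞} (hp : p ≠ 0) : Measurable fun x => eLpNorm (F x) p ν := by
  rcases eq_or_ne p ∞ with rfl | hpt
  -- The essential supremum is at most c exactly when the section of {F > c} is null, and measures
  -- of sections are measurable.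
  · refine measurable_of_Iic fun c => ?_
    have : (fun x => eLpNorm (F x) ∞ ν) ⁻¹' Set.Iic c =
        {x | ν (Prod.mk x ⁻¹' {z : α × β | c < Function.uncurry F z}) = 0} := by
      ext x
      simp only [eLpNorm_exponent_top, eLpNormEssSup_eq_essSup_enorm, enorm_eq_self,
        Set.mem_preimage, Set.mem_Iic, Set.mem_ofPred_eq]
      have h1 : ν (Prod.mk x ⁻¹' {z : α × β | c < Function.uncurry F z}) = 0 ↔
          ∀ᵐ y ∂ν, F x y ≤ c := by
        simp [ae_iff, Set.preimage, Function.uncurry]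
      rw [h1]
      exact ⟨fun h => (ENNReal.ae_le_essSup _).mono fun y hy => hy.trans h,
        fun h => essSup_le_of_ae_le c h⟩
    rw [this]
    exact measurable_measure_prodMk_left (measurableSet_lt measurable_const hF)
      (measurableSet_singleton 0)
  · simp_rw [eLpNorm_eq_lintegral_rpow_enorm_toReal hp hpt, enorm_eq_self]
    exact (hF.pow_const _).lintegral_prod_right'.pow_const _

/-- Minkowski's inequality for mixed norms: taking the smaller exponent first gives the smaller
quantity. -/
theorem eLpNorm_eLpNorm_le {α β : Type*} [MeasurableSpace α] [MeasurableSpace β]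
    {μ : Measure α} {ν : Measure β} [SFinite μ] [SigmaFinite ν] {p q : ℝ≥0∞} (hp : p ≠ 0)
    (hpq : p < q) {F : α → β → ℝ≥0∞} (hF : Measurable (Function.uncurry F)) :
    eLpNorm (fun y => eLpNorm (fun x => F x y) p μ) q ν ≤
      eLpNorm (fun x => eLpNorm (fun y => F x y) q ν) p μ := by
  have hpt : p ≠ ∞ := hpq.ne_top
  rcases eq_or_ne q ∞ with rfl | hqt
  · have hM : Measurable fun x => eLpNorm (F x) ∞ ν := measurable_eLpNorm_right hF (by simp)
    have h1 : ∀ᵐ x ∂μ, ∀ᵐ y ∂ν, F x y ≤ eLpNorm (F x) ∞ ν := ae_of_all _ fun x => by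
      simpa [eLpNorm_exponent_top, eLpNormEssSup_eq_essSup_enorm] using
        ENNReal.ae_le_essSup (μ := ν) (F x)
    -- For q = ∞, Minkowski reduces to exchanging the two "almost every" quantifiers.
    rw [Measure.ae_ae_comm (p := fun x y => F x y ≤ eLpNorm (F x) ∞ ν)
      (measurableSet_le hF (hM.comp measurable_fst))] at h1
    rw [eLpNorm_exponent_top, eLpNormEssSup_eq_essSup_enorm]
    refine essSup_le_of_ae_le _ (h1.mono fun y hy => ?_)
    exact eLpNorm_mono_enorm_ae (by simpa using hy)
  · have hq : q ≠ 0 := (bot_lt_of_lt hpq).ne'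
    have hp' := ENNReal.toReal_pos hp hpt
    have hq' := ENNReal.toReal_pos hq hqt
    have hs : 1 < q.toReal / p.toReal := by
      rw [one_lt_div hp']; exact (ENNReal.toReal_lt_toReal hpt hqt).2 hpq
    have key := ENNReal.rpow_le_rpow (lintegral_rpow_lintegral_le (μ := μ) (ν := ν) hs
      (G := fun x y => F x y ^ p.toReal) (hF.pow_const _)) (one_div_nonneg.2 hp'.le)
    simp_rw [eLpNorm_eq_lintegral_rpow_enorm_toReal hp hpt,
      eLpNorm_eq_lintegral_rpow_enorm_toReal hq hqt, enorm_eq_self, ← ENNReal.rpow_mul] at key ⊢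
    convert key using 4 <;> field_simp

/-! ### Hölder's inequality -/

/-- **Hölder's inequality** for a geometric mean of finitely many functions. The exponents may be
infinite: then `(P i).toReal⁻¹ = 0`. -/
theorem eLpNorm_prod_rpow_le {α ι : Type*} [MeasurableSpace α] {ν : Measure α} (s : Finset ι)
    {g : ι → α → ℝ≥0∞} (hg : ∀ i ∈ s, Measurable (g i)) {P : ι → ℝ≥0∞} (hP : ∀ i ∈ s, P i ≠ 0)
    {w r : ℝ} (hw : 0 ≤ w) (hr : 0 < r) (hsum : ∑ i ∈ s, w * r * (P i).toReal⁻¹ = 1) :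
    eLpNorm (fun a => ∏ i ∈ s, g i a ^ w) (ENNReal.ofReal r) ν ≤
      ∏ i ∈ s, eLpNorm (g i) (P i) ν ^ w := by
  classical
  -- Factors with infinite exponent have Hölder weight zero; their essential suprema are pulled out
  -- as constants.
  set c : ι → ℝ≥0∞ := fun i => if P i = ∞ then eLpNorm (g i) ∞ ν else 1 with hc
  have hae : ∀ᵐ a ∂ν, ∀ i ∈ s, g i a ^ (w * r) ≤
      c i ^ (w * r) * (g i a ^ (P i).toReal) ^ (w * r * (P i).toReal⁻¹) := by
    refine (Finset.eventually_all s).2 fun i hi => ?_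
    by_cases hi' : P i = ∞
    · have := ENNReal.ae_le_essSup (μ := ν) (g i)
      filter_upwards [this] with a ha
      simp only [hc, hi', if_true, ENNReal.toReal_top, ENNReal.rpow_zero, ENNReal.one_rpow, mul_one]
      refine ENNReal.rpow_le_rpow ?_ (by positivity)
      simpa [eLpNorm_exponent_top, eLpNormEssSup_eq_essSup_enorm] using ha
    · refine Filter.Eventually.of_forall fun a => le_of_eq ?_
      have := (ENNReal.toReal_pos (hP i hi) hi').ne'
      rw [← ENNReal.rpow_mul]
      simp only [hc, hi', if_false, ENNReal.one_rpow, one_mul]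
      congr 1
      field_simp
  have hfac : ∀ i ∈ s, c i ^ (w * r) *
      (∫⁻ a, g i a ^ (P i).toReal ∂ν) ^ (w * r * (P i).toReal⁻¹) =
        (eLpNorm (g i) (P i) ν ^ w) ^ r := fun i hi => by
    rw [← ENNReal.rpow_mul]
    by_cases hi' : P i = ∞
    · simp [hc, hi']
    · simp only [hc, hi', if_false, ENNReal.one_rpow, one_mul,
        eLpNorm_eq_lintegral_rpow_enorm_toReal (hP i hi) hi', enorm_eq_self, ← ENNReal.rpow_mul]
      congr 1
      ring
  rw [eLpNorm_eq_lintegral_rpow_enorm_toReal (by simpa using hr) (by simp),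
    ENNReal.toReal_ofReal hr.le, one_div, ENNReal.rpow_inv_le_iff hr]
  calc ∫⁻ a, ‖∏ i ∈ s, g i a ^ w‖ₑ ^ r ∂ν
      ≤ ∫⁻ a, (∏ i ∈ s, c i ^ (w * r)) *
          ∏ i ∈ s, (g i a ^ (P i).toReal) ^ (w * r * (P i).toReal⁻¹) ∂ν := by
        refine lintegral_mono_ae (hae.mono fun a ha => ?_)
        rw [enorm_eq_self, ← ENNReal.prod_rpow_of_nonneg hr.le, ← Finset.prod_mul_distrib]
        simp_rw [← ENNReal.rpow_mul _ w r]
        exact Finset.prod_le_prod' ha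
    _ = (∏ i ∈ s, c i ^ (w * r)) *
          ∫⁻ a, ∏ i ∈ s, (g i a ^ (P i).toReal) ^ (w * r * (P i).toReal⁻¹) ∂ν :=
        lintegral_const_mul _ (Finset.measurable_prod _ fun i hi =>
          ((hg i hi).pow_const _).pow_const _)
    _ ≤ (∏ i ∈ s, c i ^ (w * r)) *
          ∏ i ∈ s, (∫⁻ a, g i a ^ (P i).toReal ∂ν) ^ (w * r * (P i).toReal⁻¹) := by
        gcongr
        exact ENNReal.lintegral_prod_norm_pow_le s
          (fun i hi => ((hg i hi).pow_const _).aemeasurable) hsum (fun i _ => by positivity)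
    _ = (∏ i ∈ s, eLpNorm (g i) (P i) ν ^ w) ^ r := by
        rw [← Finset.prod_mul_distrib, ← ENNReal.prod_rpow_of_nonneg hr.le]
        exact Finset.prod_congr rfl hfac

/-! ### Iterated mixed norms -/

section MixedNorm

variable {δ : Type*} [DecidableEq δ] {X : δ → Type*} [∀ i, MeasurableSpace (X i)]
  (μ : ∀ i, Measure (X i))

/-- The `L^p` seminorm in the single variable `i`, as a function of all variables. -/
noncomputable def partialNorm (i : δ) (p : ℝ≥0∞) (g : (∀ i, X i) → ℝ≥0∞) (x : ∀ i, X i) : ℝ≥0∞ :=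
  eLpNorm (fun t => g (Function.update x i t)) p (μ i)

/-- The iterated mixed norm in the variables of the list `l`, outermost variable first, with the
exponent `P i` in the variable `i`. -/
noncomputable def mixedNorm (P : δ → ℝ≥0∞) (l : List δ) (g : (∀ i, X i) → ℝ≥0∞) :
    (∀ i, X i) → ℝ≥0∞ :=
  l.foldr (fun i h => partialNorm μ i (P i) h) g

variable {μ}

@[simp] theorem mixedNorm_nil (P : δ → ℝ≥0∞) (g : (∀ i, X i) → ℝ≥0∞) :
    mixedNorm μ P [] g = g := rfl

@[simp] theorem mixedNorm_cons (P : δ → ℝ≥0∞) (i : δ) (l : List δ) (g : (∀ i, X i) → ℝ≥0∞) :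
    mixedNorm μ P (i :: l) g = partialNorm μ i (P i) (mixedNorm μ P l g) := rfl

theorem partialNorm_mono (i : δ) (p : ℝ≥0∞) {g h : (∀ i, X i) → ℝ≥0∞} (hgh : g ≤ h) :
    partialNorm μ i p g ≤ partialNorm μ i p h := fun _ =>
  eLpNorm_mono_enorm fun t => by simpa using hgh _

theorem mixedNorm_mono (P : δ → ℝ≥0∞) (l : List δ) {g h : (∀ i, X i) → ℝ≥0∞} (hgh : g ≤ h) :
    mixedNorm μ P l g ≤ mixedNorm μ P l h := by
  induction l with
  | nil => exact hgh
  | cons i l ih => exact partialNorm_mono i _ ih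

variable [∀ i, SigmaFinite (μ i)]

theorem measurable_partialNorm (i : δ) {p : ℝ≥0∞} (hp : p ≠ 0) {g : (∀ i, X i) → ℝ≥0∞}
    (hg : Measurable g) : Measurable (partialNorm μ i p g) :=
  measurable_eLpNorm_right (F := fun x t => g (Function.update x i t))
    (hg.comp measurable_update') hp

theorem measurable_mixedNorm {P : δ → ℝ≥0∞} (hP : ∀ i, P i ≠ 0) (l : List δ)
    {g : (∀ i, X i) → ℝ≥0∞} (hg : Measurable g) : Measurable (mixedNorm μ P l g) := by
  induction l with
  | nil => exact hg
  | cons i l ih => exact measurable_partialNorm i (hP i) ih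

/-- This is Minkowski in the variables i and j with all others frozen. -/
theorem partialNorm_comm_le {i j : δ} (hij : i ≠ j) {p q : ℝ≥0∞} (hp : p ≠ 0) (hpq : p < q)
    {g : (∀ i, X i) → ℝ≥0∞} (hg : Measurable g) :
    partialNorm μ j q (partialNorm μ i p g) ≤ partialNorm μ i p (partialNorm μ j q g) := fun x => by
  have hF : Measurable (Function.uncurry fun (a : X i) (b : X j) =>
      g (Function.update (Function.update x j b) i a)) :=
    hg.comp (measurable_update'.comp
      (((measurable_update x).comp measurable_snd).prodMk measurable_fst))
  refine (eLpNorm_eLpNorm_le (μ := μ i) (ν := μ j) hp hpq hF).trans_eq ?_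
  simp only [partialNorm, Function.update_comm hij]

theorem partialNorm_mixedNorm_le {j : δ} {l : List δ} (hj : j ∉ l) {P : δ → ℝ≥0∞}
    (hP : ∀ i, P i ≠ 0) {q : ℝ≥0∞} (hPq : ∀ i ∈ l, P i < q) {g : (∀ i, X i) → ℝ≥0∞}
    (hg : Measurable g) :
    partialNorm μ j q (mixedNorm μ P l g) ≤ mixedNorm μ P l (partialNorm μ j q g) := by
  induction l with
  | nil => exact le_rfl
  | cons i l ih =>
    simp only [List.mem_cons, not_or, forall_eq_or_imp] at hj hPq
    exact (partialNorm_comm_le (Ne.symm hj.1) (hP i) hPq.1 (measurable_mixedNorm hP l hg)).trans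
      (partialNorm_mono i _ (ih hj.2 hPq.2))

/-- A mixed norm with exponents `p < q` can only increase when the variables with the exponent `p`
are moved to the outside. -/
theorem mixedNorm_le_filter {l : List δ} (hl : l.Nodup) (S : Finset δ) {p q : ℝ≥0∞} (hp : p ≠ 0)
    (hpq : p < q) {g : (∀ i, X i) → ℝ≥0∞} (hg : Measurable g) :
    mixedNorm μ (fun i => if i ∈ S then p else q) l g ≤
      mixedNorm μ (fun i => if i ∈ S then p else q) (l.filter (· ∈ S))
        (mixedNorm μ (fun i => if i ∈ S then p else q) (l.filter (· ∉ S)) g) := by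
  have hP : ∀ i, (fun i => if i ∈ S then p else q) i ≠ 0 := fun i => by
    dsimp only; split_ifs
    exacts [hp, (bot_lt_of_lt hpq).ne']
  induction l with
  | nil => exact le_rfl
  | cons j l ih =>
    obtain ⟨hj, hl⟩ := List.nodup_cons.1 hl
    by_cases hjS : j ∈ S
    · simp only [mixedNorm_cons, List.filter_cons, hjS, decide_true, if_true, not_true_eq_false,
        decide_false, Bool.false_eq_true, if_false]
      exact partialNorm_mono j _ (ih hl)
    · simp only [mixedNorm_cons, List.filter_cons, hjS, decide_true, if_true, not_false_eq_true,
        decide_false, Bool.false_eq_true, if_false]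
      refine (partialNorm_mono j _ (ih hl)).trans (partialNorm_mixedNorm_le (fun h => ?_) hP ?_
        (measurable_mixedNorm hP _ hg))
      · exact hj (List.mem_filter.1 h).1
      · intro i hi
        have : i ∈ S := by simpa using (List.mem_filter.1 hi).2
        simpa [this] using hpq

/-- **Hölder's inequality** for mixed norms of a geometric mean. -/
theorem mixedNorm_prod_rpow_le {ι : Type*} (s : Finset ι) {P : ι → δ → ℝ≥0∞}
    (hP : ∀ a i, P a i ≠ 0) {w r : ℝ} (hw : 0 ≤ w) (hr : 0 < r) {l : List δ}
    (hsum : ∀ i ∈ l, ∑ a ∈ s, w * r * (P a i).toReal⁻¹ = 1)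
    {g : ι → (∀ i, X i) → ℝ≥0∞} (hg : ∀ a, Measurable (g a)) (x : ∀ i, X i) :
    mixedNorm μ (fun _ => ENNReal.ofReal r) l (fun x => ∏ a ∈ s, g a x ^ w) x ≤
      ∏ a ∈ s, mixedNorm μ (P a) l (g a) x ^ w := by
  induction l generalizing x with
  | nil => exact le_rfl
  | cons i l ih =>
    simp only [List.mem_cons, forall_eq_or_imp] at hsum
    refine (partialNorm_mono (μ := μ) i _ (fun y => ih hsum.2 y) x).trans ?_
    exact eLpNorm_prod_rpow_le s
      (fun a _ => (measurable_mixedNorm (hP a) l (hg a)).comp (measurable_update x))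
      (fun a _ => hP a i) hw hr hsum.1

/-- With equal finite exponents the intermediate roots and powers cancel, and Tonelli merges the
nested integrals. -/
theorem mixedNorm_rpow_eq_lmarginal {l : List δ} (hl : l.Nodup) {P : δ → ℝ≥0∞} {p : ℝ≥0∞}
    (hP : ∀ i ∈ l, P i = p) (hp : p ≠ 0) (hpt : p ≠ ∞) {g : (∀ i, X i) → ℝ≥0∞}
    (hg : Measurable g) (x : ∀ i, X i) :
    mixedNorm μ P l g x ^ p.toReal = lmarginal μ l.toFinset (fun y => g y ^ p.toReal) x := by
  induction l generalizing x with
  | nil => simp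
  | cons i l ih =>
    obtain ⟨hi, hl⟩ := List.nodup_cons.1 hl
    simp only [List.mem_cons, forall_eq_or_imp] at hP
    rw [List.toFinset_cons, lmarginal_insert _ (hg.pow_const _) (by simpa using hi)]
    simp_rw [← ih hl hP.2]
    rw [mixedNorm_cons, partialNorm, hP.1, eLpNorm_eq_lintegral_rpow_enorm_toReal hp hpt, one_div,
      ENNReal.rpow_inv_rpow (ENNReal.toReal_pos hp hpt).ne']
    simp

/-- Counterpart for exponent ∞. Nullity of {g > c} is phrased as a vanishing integral, so that
Tonelli peels off one variable at a time. -/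
theorem mixedNorm_top_le {l : List δ} (hl : l.Nodup) {P : δ → ℝ≥0∞} (hP : ∀ i ∈ l, P i = ∞)
    {g : (∀ i, X i) → ℝ≥0∞} (hg : Measurable g) {c : ℝ≥0∞} (x : ∀ i, X i)
    (h : lmarginal μ l.toFinset ({y | c < g y}.indicator 1) x = 0) :
    mixedNorm μ P l g x ≤ c := by
  have hm : Measurable ({y | c < g y}.indicator (1 : (∀ i, X i) → ℝ≥0∞)) :=
    measurable_one.indicator (measurableSet_lt measurable_const hg)
  induction l generalizing x with
  | nil => simpa using h
  | cons i l ih =>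
    obtain ⟨hi, hl⟩ := List.nodup_cons.1 hl
    simp only [List.mem_cons, forall_eq_or_imp] at hP
    rw [List.toFinset_cons, lmarginal_insert _ hm (by simpa using hi),
      lintegral_eq_zero_iff (f := fun t => lmarginal μ l.toFinset _ (Function.update x i t))
        ((hm.lmarginal μ).comp (measurable_update x))] at h
    rw [mixedNorm_cons, partialNorm, hP.1, eLpNorm_exponent_top, eLpNormEssSup_eq_essSup_enorm]
    exact essSup_le_of_ae_le _ (h.mono fun t ht => ih hl hP.2 _ ht)

end MixedNorm

/-! ### The exponent and the averaging over subsets -/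

/-- This is the Hölder condition. For q = ∞ the defaults `∞.toReal = 0` and `0⁻¹ = 0` give the
correct 1/q = 0. Positivity of `toReal` also rules out the exponents 0 and ∞. -/
theorem bleiExponent_toReal {J K : ℕ} (hK : 0 < K) (hKJ : K < J) {p q : ℝ≥0∞} (hp : 0 < p)
    (hpq : p < q) : 0 < (bleiExponent J K p q).toReal ∧
      (bleiExponent J K p q).toReal *
        (K / J * p.toReal⁻¹ + (1 - K / J) * q.toReal⁻¹) = 1 := by
  have hpt : p ≠ ∞ := hpq.ne_top
  have hp' := ENNReal.toReal_pos hp.ne' hpt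
  have hK' : (0 : ℝ) < K := by exact_mod_cast hK
  have hJ' : (0 : ℝ) < J := by exact_mod_cast hK.trans hKJ
  rcases eq_or_ne q ∞ with rfl | hqt
  · simp only [bleiExponent, if_true, ENNReal.toReal_div, ENNReal.toReal_mul, ENNReal.toReal_natCast,
      ENNReal.toReal_top, inv_zero, mul_zero, add_zero]
    exact ⟨by positivity, by field_simp⟩
  · have hq' := ENNReal.toReal_pos (hp.trans hpq).ne' hqt
    have hlt : p.toReal < q.toReal := (ENNReal.toReal_lt_toReal hpt hqt).2 hpq
    have hr : (bleiExponent J K p q).toReal = J * p.toReal * q.toReal /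
        (p.toReal * J + (q.toReal - p.toReal) * K) := by
      rw [bleiExponent, if_neg hqt, ENNReal.toReal_div, ENNReal.toReal_add
        (ENNReal.mul_ne_top hpt (by simp))
        (ENNReal.mul_ne_top (ENNReal.sub_ne_top hqt) (by simp))]
      simp [ENNReal.toReal_mul, ENNReal.toReal_sub_of_le hpq.le hqt]
    have hden : 0 < p.toReal * J + (q.toReal - p.toReal) * K := by
      have := sub_pos.2 hlt
      positivity
    rw [hr]
    refine ⟨by positivity, ?_⟩
    rw [div_mul_eq_mul_div, div_eq_one_iff_eq hden.ne']
    field_simp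
    ring

/-- Averaging over the `K`-element subsets of `Fin J`: a fixed index lies in the proportion `K / J`
of them. -/
theorem sum_powersetCard_ite {J K : ℕ} (hK : 0 < K) (hKJ : K < J) (i : Fin J) (a b : ℝ) :
    ∑ S ∈ (Finset.univ : Finset (Fin J)).powersetCard K, (if i ∈ S then a else b) =
      J.choose K * (K / J * a + (1 - K / J) * b) := by
  have hcard : ((Finset.univ : Finset (Fin J)).powersetCard K).card = J.choose K := by simp
  have h1 : (((Finset.univ : Finset (Fin J)).powersetCard K).filter (i ∈ ·)).card =
      (J - 1).choose (K - 1) := by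
    have := Finset.card_filter_powersetCard_subset {i} (Finset.univ : Finset (Fin J)) K
      (by simp)
    simpa [Nat.one_le_iff_ne_zero.2 hK.ne'] using this
  have h2 : (((Finset.univ : Finset (Fin J)).powersetCard K).filter (i ∈ ·)).card +
      (((Finset.univ : Finset (Fin J)).powersetCard K).filter (i ∉ ·)).card = J.choose K := by
    rw [Finset.card_filter_add_card_filter_not, hcard]
  have h3 : J * (J - 1).choose (K - 1) = J.choose K * K := by
    obtain ⟨j, rfl⟩ : ∃ j, J = j + 1 := ⟨J - 1, by omega⟩
    obtain ⟨k, rfl⟩ : ∃ k, K = k + 1 := ⟨K - 1, by omega⟩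
    exact Nat.add_one_mul_choose_eq j k
  have hJ' : (J : ℝ) ≠ 0 := by
    have := hK.trans hKJ
    positivity
  rw [h1] at h2
  have h2' : (((J - 1).choose (K - 1) : ℕ) : ℝ) +
      (((Finset.univ : Finset (Fin J)).powersetCard K).filter (i ∉ ·)).card = J.choose K := by
    exact_mod_cast h2
  have h3' : (J : ℝ) * ((J - 1).choose (K - 1) : ℕ) = J.choose K * K := by exact_mod_cast h3
  have h4 : (((J - 1).choose (K - 1) : ℕ) : ℝ) = J.choose K * K / J := by
    rw [eq_div_iff hJ', ← h3', mul_comm]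
  rw [Finset.sum_ite, Finset.sum_const, Finset.sum_const, h1, nsmul_eq_mul, nsmul_eq_mul,
    eq_sub_of_add_eq' h2', h4]
  ring

/-! ### Comparison with the mixed integrals -/

section GluePoint

variable {J : ℕ} {X : Fin J → Type*} [∀ i, MeasurableSpace (X i)]

theorem measurable_gluePoint (S : Finset (Fin J)) :
    Measurable fun z : (∀ i, X i) × ((i : {i // i ∉ S}) → X i) =>
      gluePoint S (fun i => z.1 i) z.2 := by
  refine measurable_pi_lambda _ fun i => ?_
  by_cases h : i ∈ S
  · simp only [gluePoint, h, dif_pos]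
    fun_prop
  · simp only [gluePoint, h, dif_neg, not_false_eq_true]
    fun_prop

variable (μ : ∀ i, Measure (X i))

/-- The inner norm of a mixed integral, as a function of all variables. -/
noncomputable def innerNorm (q : ℝ≥0∞) (S : Finset (Fin J)) (f : (∀ i, X i) → ℂ)
    (z : ∀ i, X i) : ℝ≥0∞ :=
  eLpNorm (fun y : ((i : {i // i ∉ S}) → X i) => f (gluePoint S (fun i => z i) y)) q
    (Measure.pi fun i : {i // i ∉ S} => μ i)

variable {μ}

theorem mixedIntegral_eq_lmarginal (p q : ℝ≥0∞) (S : Finset (Fin J)) (f : (∀ i, X i) → ℂ)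
    (z : ∀ i, X i) :
    mixedIntegral μ p q S f = lmarginal μ S (fun y => innerNorm μ q S f y ^ p.toReal) z := by
  simp [mixedIntegral, lmarginal, innerNorm, Function.updateFinset]

variable [∀ i, SigmaFinite (μ i)]

/-- Only a reindexing: the complement of S appears as the subtype `i ∉ S` on one side and `i ∈ Sᶜ`
on the other. -/
theorem lintegral_gluePoint (S : Finset (Fin J)) (h : (∀ i, X i) → ℝ≥0∞) (z : ∀ i, X i) :
    ∫⁻ y : ((i : {i // i ∉ S}) → X i), h (gluePoint S (fun i => z i) y)
      ∂(Measure.pi fun i : {i // i ∉ S} => μ i) = lmarginal μ Sᶜ h z := by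
  let e : {i // i ∉ S} ≃ {i // i ∈ Sᶜ} := Equiv.subtypeEquivRight (by simp)
  rw [lmarginal, (measurePreserving_piCongrLeft (fun i : {i // i ∈ Sᶜ} => μ i) e).lintegral_map_equiv]
  refine lintegral_congr fun y => congrArg h (funext fun i => ?_)
  by_cases hi : i ∈ S
  · simp [gluePoint, Function.updateFinset, hi]
  · simp only [gluePoint, Function.updateFinset, hi, dif_neg, not_false_eq_true,
      Finset.mem_compl, dif_pos]
    exact (MeasurableEquiv.piCongrLeft_apply_apply e (β := fun i : {i // i ∈ Sᶜ} => X i)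
      y ⟨i, hi⟩).symm

theorem measurable_innerNorm {q : ℝ≥0∞} (hq : q ≠ 0) (S : Finset (Fin J))
    {f : (∀ i, X i) → ℂ} (hf : Measurable f) : Measurable (innerNorm μ q S f) := by
  have := measurable_eLpNorm_right (ν := Measure.pi fun i : {i // i ∉ S} => μ i)
    (F := fun (z : ∀ i, X i) y => ‖f (gluePoint S (fun i => z i) y)‖ₑ)
    ((hf.comp (measurable_gluePoint S)).enorm) hq
  simp only [eLpNorm_enorm] at this
  exact this

theorem mixedNorm_le_innerNorm {q : ℝ≥0∞} (hq : q ≠ 0) {S : Finset (Fin J)} {l : List (Fin J)}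
    (hl : l.Nodup) (hlS : l.toFinset = Sᶜ) {P : Fin J → ℝ≥0∞} (hP : ∀ i ∈ l, P i = q)
    {f : (∀ i, X i) → ℂ} (hf : Measurable f) :
    mixedNorm μ P l (fun x => ‖f x‖ₑ) ≤ innerNorm μ q S f := fun x => by
  rcases eq_or_ne q ∞ with rfl | hqt
  · refine mixedNorm_top_le hl hP hf.enorm x ?_
    rw [hlS, ← lintegral_gluePoint]
    set c := innerNorm μ ∞ S f x with hc
    rw [innerNorm, eLpNorm_exponent_top, eLpNormEssSup_eq_essSup_enorm] at hc
    refine (lintegral_congr_ae ?_).trans lintegral_zero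
    filter_upwards [ENNReal.ae_le_essSup (μ := Measure.pi fun i : {i // i ∉ S} => μ i)
      fun y => ‖f (gluePoint S (fun i => x i) y)‖ₑ] with y hy
    rw [← hc] at hy
    simpa using hy
  · have hq' := ENNReal.toReal_pos hq hqt
    refine le_of_eq (ENNReal.rpow_left_injective hq'.ne' ?_)
    dsimp only
    rw [mixedNorm_rpow_eq_lmarginal hl hP hq hqt hf.enorm, hlS, ← lintegral_gluePoint, innerNorm,
      eLpNorm_eq_lintegral_rpow_enorm_toReal hq hqt, one_div, ENNReal.rpow_inv_rpow hq'.ne']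

/-- Minkowski sorts the variables, those of S outermost; each of the two blocks then has a constant
exponent and collapses to a norm over a product space. -/
theorem mixedNorm_le_mixedIntegral {p q : ℝ≥0∞} (hp : p ≠ 0) (hpq : p < q) (S : Finset (Fin J))
    {f : (∀ i, X i) → ℂ} (hf : Measurable f) (x : ∀ i, X i) :
    mixedNorm μ (fun i => if i ∈ S then p else q) (List.finRange J) (fun x => ‖f x‖ₑ) x ≤
      mixedIntegral μ p q S f ^ p.toReal⁻¹ := by
  have hq : q ≠ 0 := (bot_lt_of_lt hpq).ne'
  have hnd := List.nodup_finRange J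
  refine (mixedNorm_le_filter hnd S hp hpq hf.enorm x).trans ?_
  have hinner := mixedNorm_le_innerNorm (μ := μ) hq (S := S)
    (l := (List.finRange J).filter (· ∉ S)) (P := fun i => if i ∈ S then p else q)
    (hnd.filter _) (by ext i; simp) (by simp +contextual) hf
  refine (mixedNorm_mono _ _ hinner x).trans ?_
  rw [ENNReal.le_rpow_inv_iff (ENNReal.toReal_pos hp hpq.ne_top),
    mixedNorm_rpow_eq_lmarginal (p := p) (hnd.filter _) (by simp +contextual) hp hpq.ne_top
      (measurable_innerNorm hq S hf), mixedIntegral_eq_lmarginal p q S f x]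
  refine le_of_eq ?_
  congr 1
  ext i
  simp

end GluePoint

/-! ### The inequality -/

theorem proposition4p3 {J K : ℕ} (hK : 0 < K) (hKJ : K < J)
    {p q : ℝ≥0∞} (hp : 0 < p) (hpq : p < q)
    {X : Fin J → Type*} [∀ i, MeasurableSpace (X i)]
    (μ : ∀ i, Measure (X i)) [∀ i, SigmaFinite (μ i)]
    (f : (∀ i, X i) → ℂ) (hf : Measurable f) :
    eLpNorm f (bleiExponent J K p q) (Measure.pi μ) ≤
      ∏ S ∈ (Finset.univ : Finset (Fin J)).powersetCard K,
        (mixedIntegral μ p q S f) ^ (1 / ((J.choose K : ℝ) * p.toReal)) := by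
  -- Mixed norms are functions of all variables, so a base point is needed to evaluate them, even
  -- when every variable is integrated out.
  rcases isEmpty_or_nonempty (∀ i, X i) with hX | ⟨⟨x⟩⟩
  · simp [Measure.eq_zero_of_isEmpty]
  obtain ⟨hr, hrsum⟩ := bleiExponent_toReal hK hKJ hp hpq
  have hr0 : bleiExponent J K p q ≠ 0 := fun h => by simp [h] at hr
  have hrt : bleiExponent J K p q ≠ ∞ := fun h => by simp [h] at hr
  set r := (bleiExponent J K p q).toReal with hrdef
  have hN : (0 : ℝ) < J.choose K := by exact_mod_cast Nat.choose_pos hKJ.le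
  set w : ℝ := (J.choose K : ℝ)⁻¹ with hw
  set s := (Finset.univ : Finset (Fin J)).powersetCard K with hs
  have hprod : (fun x => ‖f x‖ₑ) = fun x => ∏ _S ∈ s, ‖f x‖ₑ ^ w := by
    funext x
    rw [Finset.prod_const, ← ENNReal.rpow_natCast, ← ENNReal.rpow_mul]
    simp [hs, hw, hN.ne']
  have hlhs : eLpNorm f (bleiExponent J K p q) (Measure.pi μ) =
      mixedNorm μ (fun _ => ENNReal.ofReal r) (List.finRange J) (fun x => ‖f x‖ₑ) x := by
    refine ENNReal.rpow_left_injective hr.ne' ?_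
    have := mixedNorm_rpow_eq_lmarginal (μ := μ) (List.nodup_finRange J)
      (P := fun _ => ENNReal.ofReal r) (fun _ _ => rfl) (by simpa using hr) (by simp) hf.enorm x
    rw [ENNReal.toReal_ofReal hr.le] at this
    dsimp only
    rw [this, eLpNorm_eq_lintegral_rpow_enorm_toReal hr0 hrt, one_div,
      ENNReal.rpow_inv_rpow hr.ne', lintegral_eq_lmarginal_univ x]
    congr 1
    ext i
    simp
  rw [hlhs, hprod]
  refine (mixedNorm_prod_rpow_le s (P := fun S i => if i ∈ S then p else q)
    (fun S i => ?_) (by positivity) hr (fun i _ => ?_) (fun _ => hf.enorm) x).trans ?_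
  · split_ifs
    exacts [hp.ne', (hp.trans hpq).ne']
  · simp_rw [apply_ite ENNReal.toReal, apply_ite (fun t : ℝ => t⁻¹)]
    rw [← Finset.mul_sum, sum_powersetCard_ite hK hKJ]
    have hwN : w * J.choose K = 1 := inv_mul_cancel₀ hN.ne'
    -- The Hölder condition is the averaged identity `hrsum`, once the weight w = 1/N has cancelled
    -- the number N of subsets.
    linear_combination
      (r * (K / J * p.toReal⁻¹ + (1 - K / J) * q.toReal⁻¹)) * hwN + hrsum
  · refine Finset.prod_le_prod' fun S _ => ?_
    calc _ ≤ (mixedIntegral μ p q S f ^ p.toReal⁻¹) ^ w :=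
          ENNReal.rpow_le_rpow (mixedNorm_le_mixedIntegral hp.ne' hpq S hf x) (by positivity)
      _ = _ := by rw [← ENNReal.rpow_mul, hw, one_div, mul_inv, mul_comm]
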